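/- All graphs are finite and simple, and a class of graphs is an arbitrary class of finite graphs (not assumed hereditary). Definitions. A class $\mathscr C$ is *weakly sparse* if there is $t\in\mathbb N$ such that no graph of $\mathscr C$ contains $K_{t,t}$ as a (not necessarily induced) subgraph. A graph $H$ is a *depth-$r$ topological minor* of $G$ if $G$ contains a subgraph isomorphic to a graph obtained from $H$ by subdividing each edge at most $2r$ times. $\mathscr C$ is *nowhere dense* if there is $f\colon\mathbb N\to\mathbb N$ such that $\omega(H)\le f(r)$ for every $r\in\mathbb N$ and every depth-$r$ topological minor $H$ of a graph of $\mathscr C$. A *monadic lift* of a graph $G$ is an expansion of $G$, viewed as a structure over one binary edge relation, by finitely many unary predicates. $\mathscr C$ is *monadically NIP* if for every first-order formula $\varphi(x,y)$ over the signature of graphs expanded by finitely many unary predicates there is $k\in\mathbb N$ such that, for every monadic lift $G^+$ of a graph $G\in\mathscr C$ and all vertices $a_i$ ($i\in[\ell]$), $b_I$ ($I\subseteq[\ell]$) of $G$ with $G^+\models\varphi(a_i,b_I)\iff i\in I$ for all $i\in[\ell]$ and $I\subseteq[\ell]$, we have $\ell\le k$. There is a *transduction* from $\mathscr C$ to $\mathscr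 D$ if for some number of unary predicates there are first-order formulas $\nu(x)$, $\eta(x,y)$ over the correspondingly expanded signature such that every $H\in\mathscr D$ is isomorphic to the structure with domain $\nu(G^+)$ and edge relation $\eta(G^+)\cap\nu(G^+)^2$ for some monadic lift $G^+$ of some $G\in\mathscr C$. $\mathscr C$ is *sparsifiable* if there are a weakly sparse class $\mathscr D$ of graphs and transductions from $\mathscr C$ to $\mathscr D$ and from $\mathscr D$ to $\mathscr C$. $\mathscr C$ is *structurally nowhere dense* if there is a transduction from some nowhere dense class of graphs to $\mathscr C$. Theorem. Let $\mathscr C$ be a monadically NIP class of graphs. Then $\mathscr C$ is nowhere dense if and only if it is weakly sparse. Consequently, if $\mathscr C$ is moreover sparsifiable, then $\mathscr C$ is structurally nowhere dense. -/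

import Mathlib

open FirstOrder

universe u

/-! ### Finite graphs, classes of graphs, bicliques -/

/-- A finite simple graph. -/
structure FinGraph where
  /-- the vertex set -/
  V : Type u
  /-- the vertex set is finite (and possibly empty) -/
  [finite : Finite V]
  /-- the edge relation -/
  graph : SimpleGraph V

/-- A class of finite graphs. It need not be closed under isomorphism, nor hereditary: all the
properties of classes defined below are insensitive to replacing graphs by isomorphic ones. -/
abbrev GraphClass := Set FinGraph.{u}

/-- A class of graphs is weakly sparse if some biclique `K_{t,t}` is not a subgraph
(up to isomorphism, not necessarily induced) of any graph in the class. -/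
def GraphClass.IsWeaklySparse (C : GraphClass.{u}) : Prop :=
  ∃ t : ℕ, ∀ G ∈ C, ¬ (completeBipartiteGraph (Fin t) (Fin t)).IsContained G.graph

/-! ### Subdivisions, topological minors, nowhere dense classes -/

namespace SimpleGraph

variable {V : Type u} (H : SimpleGraph V) (s : H.edgeSet → ℕ)

/-- The vertices of the path that replaces the edge `e` when it is subdivided `s e` times: the
`0`-th and the `(s e + 1)`-st one are the two ends of `e` (in an arbitrary order), and the ones
in between are the `s e` new vertices that belong to `e`. -/
noncomputable def subdivisionPath (e : H.edgeSet) (i : ℕ) : V ⊕ (Σ e : H.edgeSet, Fin (s e)) :=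
  if i = 0 then Sum.inl (Quot.out e.1).1
  else if h : i - 1 < s e then Sum.inr ⟨e, ⟨i - 1, h⟩⟩
  else Sum.inl (Quot.out e.1).2

/-- The graph obtained from `H` by subdividing each edge `e` exactly `s e` times, i.e. replacing
`e` by a path with `s e` inner vertices (so `s e + 1` edges). -/
noncomputable def subdivision : SimpleGraph (V ⊕ (Σ e : H.edgeSet, Fin (s e))) :=
  fromEdgeSet {z | ∃ (e : H.edgeSet) (i : ℕ), i ≤ s e ∧
    z = s(H.subdivisionPath s e i, H.subdivisionPath s e (i + 1))}

/-- `H` is a depth-`r` topological minor of `G`: some subgraph of `G` is isomorphic to a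
`≤ 2r`-subdivision of `H`, in which each edge is subdivided at most `2r` times. -/
def IsTopologicalMinorOfDepth (r : ℕ) {W : Type u} (G : SimpleGraph W) : Prop :=
  ∃ s : H.edgeSet → ℕ, (∀ e, s e ≤ 2 * r) ∧ (H.subdivision s).IsContained G

end SimpleGraph

/-- A class `C` is nowhere dense if there is a function `f` such that `ω(H) ≤ f r` for every `r`
and every depth-`r` topological minor `H` of a graph from `C`. -/
def GraphClass.IsNowhereDense (C : GraphClass.{u}) : Prop :=
  ∃ f : ℕ → ℕ, ∀ (r : ℕ), ∀ G ∈ C, ∀ H : FinGraph.{u},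
    H.graph.IsTopologicalMinorOfDepth r G.graph → H.graph.cliqueNum ≤ f r

/-! ### Monadic lifts -/

/-- `n` unary relation symbols. -/
inductive UnaryRel (n : ℕ) : ℕ → Type
  | mark : Fin n → UnaryRel n 1

/-- The signature consisting of `n` unary relation symbols. -/
def unaryLanguage (n : ℕ) : Language := ⟨fun _ => Empty, UnaryRel n⟩

/-- The signature of graphs expanded by `n` unary relation symbols. -/
abbrev markedGraphLanguage (n : ℕ) : Language := Language.graph.sum (unaryLanguage n)

/-- The interpretation of the `n` unary relation symbols by the subsets `U 0, …, U (n - 1)`. -/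
@[reducible] def unaryStructure {V : Type u} {n : ℕ} (U : Fin n → Set V) :
    (unaryLanguage n).Structure V where
  funMap := fun f => Empty.elim f
  RelMap | .mark j => fun x => x 0 ∈ U j

/-- The monadic lift of the graph `G` by the unary predicates `U 0, …, U (n - 1)`. -/
@[reducible] def SimpleGraph.monadicLift {V : Type u} (G : SimpleGraph V) {n : ℕ}
    (U : Fin n → Set V) : (markedGraphLanguage n).Structure V :=
  @Language.sumStructure Language.graph (unaryLanguage n) V G.structure (unaryStructure U)

/-- The monadic lift of `G` by `U` satisfies the formula `φ` under the assignment `v`. -/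
def SimpleGraph.LiftSatisfies {V : Type u} (G : SimpleGraph V) {n : ℕ} (U : Fin n → Set V)
    {α : Type} (φ : (markedGraphLanguage n).Formula α) (v : α → V) : Prop :=
  @Language.Formula.Realize (markedGraphLanguage n) V (G.monadicLift U) α φ v

/-- A class of graphs is monadically NIP (monadically dependent) if for every first-order formula
`φ(x, y)` in the language of graphs with additional unary predicates there is `k` such that,
whenever in a monadic lift of a graph of the class there are elements `a i` (`i ∈ [ℓ]`)
and `b I` (`I ⊆ [ℓ]`) with `φ(a i, b I) ↔ i ∈ I` for all `i` and `I`, then `ℓ ≤ k`. -/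
def GraphClass.IsMonadicallyNIP (C : GraphClass.{u}) : Prop :=
  ∀ (n : ℕ) (φ : (markedGraphLanguage n).Formula (Fin 2)), ∃ k : ℕ,
    ∀ G ∈ C, ∀ (U : Fin n → Set G.V) (l : ℕ) (a : Fin l → G.V) (b : Set (Fin l) → G.V),
      (∀ (i : Fin l) (I : Set (Fin l)), G.graph.LiftSatisfies U φ ![a i, b I] ↔ i ∈ I) → l ≤ k

/-! ### Interpretations and transductions -/

/-- A (one-dimensional) first-order interpretation of graphs in graphs with `n` additional unary
predicates: a formula `ν(x)` defining the domain, and a formula `η(x, y)` defining the edges. -/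
structure GraphInterpretation (n : ℕ) where
  /-- the formula defining the domain -/
  ν : (markedGraphLanguage n).Formula (Fin 1)
  /-- the formula defining the edge relation -/
  η : (markedGraphLanguage n).Formula (Fin 2)

/-- The domain of the interpreted structure. -/
def GraphInterpretation.domain {n : ℕ} (I : GraphInterpretation n) {V : Type u}
    (G : SimpleGraph V) (U : Fin n → Set V) : Set V :=
  {x | G.LiftSatisfies U I.ν ![x]}

/-- The edge relation of the interpreted structure. -/
def GraphInterpretation.edge {n : ℕ} (I : GraphInterpretation n) {V : Type u}
    (G : SimpleGraph V) (U : Fin n → Set V) (x y : I.domain G U) : Prop :=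
  G.LiftSatisfies U I.η ![x.1, y.1]

/-- There is a transduction from `C` to `D`: for some interpretation `I`, every graph in `D` is
(isomorphic to) the result of applying `I` to a monadic lift of a graph in `C`. -/
def GraphClass.TransducesTo (C D : GraphClass.{u}) : Prop :=
  ∃ (n : ℕ) (I : GraphInterpretation n), ∀ B ∈ D, ∃ A ∈ C, ∃ U : Fin n → Set A.V,
    Nonempty (B.graph.Adj ≃r I.edge A.graph U)

/-- A class is sparsifiable if it is transduction-equivalent to a weakly sparse class. -/
def GraphClass.IsSparsifiable (C : GraphClass.{u}) : Prop :=
  ∃ D : GraphClass.{u}, D.IsWeaklySparse ∧ C.TransducesTo D ∧ D.TransducesTo C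

/-- A class is structurally nowhere dense if it is a transduction of a nowhere dense class. -/
def GraphClass.IsStructurallyNowhereDense (C : GraphClass.{u}) : Prop :=
  ∃ D : GraphClass.{u}, D.IsNowhereDense ∧ D.TransducesTo C

/-! ### Bicliques and product Ramsey -/

/-! If a weakly sparse class is not nowhere dense, then for some `r` its graphs contain `≤
2r`-subdivisions of arbitrarily large cliques, but possibly with extra edges. The extra edges are
cleaned up by indexing the clique by `ι × Fin n`: choosing one copy of each `p : ι` is a point of a
box, and product Ramsey makes the adjacency pattern of the chosen vertices constant on a sub-box. An
edge between vertices depending on incomparable sets of coordinates would then give a biclique,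
since each end can be varied without moving the other (`exists_point_adj_imp_comparable`). What
survives is harmless (`exists_clean_subdivision`). Take `ι` to be the indices `i` together with the
sets `I`, and mark the inner vertices of the paths from `i` to `I` with `i ∈ I`: short walks through
marked vertices define membership, against monadic NIP. For sparsifiable classes, monadic NIP passes
to the weakly sparse partner by pulling formulas back along the transduction, so that partner is
nowhere dense. -/

theorem SimpleGraph.completeBipartiteGraph_isContained_of_adj {V α β : Type*} {G : SimpleGraph V}
    {f : α → V} {g : β → V} (hf : f.Injective) (hg : g.Injective)
    (h : ∀ a b, G.Adj (f a) (g b)) : (completeBipartiteGraph α β).IsContained G := by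
  refine ⟨⟨⟨Sum.elim f g, ?_⟩, ?_⟩⟩
  · rintro (a | a) (b | b) hab
    · simp at hab
    · exact h a b
    · exact (h b a).symm
    · simp at hab
  · refine hf.sumElim hg fun a b hab => ?_
    have := h a b
    rw [hab] at this
    exact this.ne rfl

/-- Product Ramsey theorem: a finite colouring of a large enough box is constant on a sub-box
all of whose sides have size `t`. -/
theorem exists_monochromatic_box (ι : Type) [Finite ι] :
    ∀ (t : ℕ) (K : Type) [Finite K], ∃ n : ℕ, ∀ c : (ι → Fin n) → K,
      ∃ f : ι → Fin t → Fin n, (∀ i, (f i).Injective) ∧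
        ∃ κ, ∀ τ : ι → Fin t, c (fun i => f i (τ i)) = κ := by
  induction ι using Finite.induction_empty_option with
  | of_equiv e ih =>
    intro t K _
    obtain ⟨n, hn⟩ := ih t K
    refine ⟨n, fun c => ?_⟩
    obtain ⟨f, hf, κ, h⟩ := hn fun τ => c (τ ∘ e.symm)
    refine ⟨f ∘ e.symm, fun i => hf _, κ, fun τ => ?_⟩
    rw [← h (τ ∘ e)]
    congr 1
    ext i
    simp
  | h_empty =>
    intro t K _
    refine ⟨0, fun c => ⟨fun i => i.elim, fun i => i.elim, c fun i => i.elim, fun τ => ?_⟩⟩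
    congr 1
    ext i
    exact i.elim
  | @h_option ι _ ih =>
    intro t K _
    have := Fintype.ofFinite K
    classical
    -- Colour a point of the smaller box by the colours of all its extensions by the new coordinate.
    -- With `|K| * t + 1` values there, pigeonhole repeats one colour more than `t` times.
    obtain ⟨n, hn⟩ := ih t (Fin (Fintype.card K * t + 1) → K)
    have h₁ := le_max_left (Fintype.card K * t + 1) n
    have h₂ := le_max_right (Fintype.card K * t + 1) n
    refine ⟨max (Fintype.card K * t + 1) n, fun c => ?_⟩
    obtain ⟨f, hf, κ, h⟩ := hn fun τ m =>
      c fun i => i.elim (Fin.castLE h₁ m) fun j => Fin.castLE h₂ (τ j)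
    obtain ⟨y, hy⟩ := Fintype.exists_lt_card_fiber_of_mul_lt_card κ (n := t) (by simp)
    obtain ⟨s, hs, hst⟩ := Finset.exists_subset_card_eq hy.le
    let g := s.equivFinOfCardEq hst
    refine ⟨fun i => i.elim (fun a => Fin.castLE h₁ (g.symm a)) fun j a => Fin.castLE h₂ (f j a),
      ?_, y, fun τ => ?_⟩
    · rintro (_ | j)
      · exact (Fin.castLE_injective h₁).comp (Subtype.val_injective.comp g.symm.injective)
      · exact (Fin.castLE_injective h₂).comp (hf j)
    · have hm := (Finset.mem_filter.1 (hs (g.symm (τ none)).2)).2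
      rw [← hm, ← h fun j => τ (some j)]
      congr 1
      ext (_ | j) <;> rfl

/-- In a graph without large bicliques, consider objects (each of them a vertex, if defined) that
depend injectively on the coordinates of a point of a box that belong to their supports. If the box
is large enough, then for some point of the box only objects with comparable supports are
adjacent. -/
theorem exists_point_adj_imp_comparable (t : ℕ) (ι J : Type) [Finite ι] [Finite J] :
    ∃ n : ℕ, ∀ {V : Type u} (G : SimpleGraph V),
      ¬ (completeBipartiteGraph (Fin t) (Fin t)).IsContained G →
      ∀ (supp : J → Set ι) (ob : (ι → Fin n) → J → Option V),
        (∀ τ τ' j, (∀ i ∈ supp j, τ i = τ' i) → ob τ j = ob τ' j) →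
        (∀ τ τ' j v, ob τ j = some v → ob τ' j = some v → ∀ i ∈ supp j, τ i = τ' i) →
        ∃ τ, ∀ j j' v v', ob τ j = some v → ob τ j' = some v' → G.Adj v v' →
          supp j ⊆ supp j' ∨ supp j' ⊆ supp j := by
  -- Side `t + 1` ensures that the sub-box has a base point `0` even if `t = 0`.
  obtain ⟨n, hn⟩ := exists_monochromatic_box ι (t + 1) (J → J → Prop)
  refine ⟨n, fun {V} G hG supp ob hdep hinj => ?_⟩
  obtain ⟨f, hf, κ, hκ⟩ := hn fun τ j j' =>
    ∃ v v', ob τ j = some v ∧ ob τ j' = some v' ∧ G.Adj v v'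
  refine ⟨fun i => f i 0, fun j j' v v' hv hv' hadj => ?_⟩
  by_contra! hcon
  simp only [Set.not_subset] at hcon
  obtain ⟨⟨i, hi, hi'⟩, i', hi₂, hi₂'⟩ := hcon
  have hne : i ≠ i' := fun h => hi' (h ▸ hi₂)
  classical
  let σ (a b : Fin (t + 1)) : ι → Fin n :=
    fun k => f k (if k = i then a else if k = i' then b else 0)
  have hκj : κ j j' := by
    have := congrFun (congrFun (hκ fun _ => 0) j) j'
    rw [← this]
    exact ⟨v, v', hv, hv', hadj⟩
  -- Object `j` ignores coordinate `i'` and object `j'` ignores `i`, so the edge present at the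
  -- point with coordinates `a` and `b` joins a vertex depending only on `a` to one depending only
  -- on `b`.
  have key : ∀ a b, ∃ v v', ob (σ a 0) j = some v ∧ ob (σ 0 b) j' = some v' ∧ G.Adj v v' := by
    intro a b
    have := congrFun (congrFun (hκ fun k => if k = i then a else if k = i' then b else 0) j) j'
    rw [← this] at hκj
    obtain ⟨v, v', hv, hv', h⟩ := hκj
    refine ⟨v, v', ?_, ?_, h⟩
    · rw [← hv]
      refine hdep _ _ _ fun k hk => ?_
      have : k ≠ i' := fun h => hi₂' (h ▸ hk)
      simp [σ, this]
    · rw [← hv']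
      refine hdep _ _ _ fun k hk => ?_
      have : k ≠ i := fun h => hi' (h ▸ hk)
      simp [σ, this]
  have h₁ : ∀ a, ∃ v, ob (σ a 0) j = some v := fun a => let ⟨v, _, h, _⟩ := key a 0; ⟨v, h⟩
  have h₂ : ∀ b, ∃ v, ob (σ 0 b) j' = some v := fun b => let ⟨_, v, _, h, _⟩ := key 0 b; ⟨v, h⟩
  choose F hF using h₁
  choose F' hF' using h₂
  refine hG (SimpleGraph.completeBipartiteGraph_isContained_of_adj (f := F ∘ Fin.castSucc)
    (g := F' ∘ Fin.castSucc) (.comp (fun a a' h => ?_) (Fin.castSucc_injective t))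
    (.comp (fun b b' h => ?_) (Fin.castSucc_injective t)) fun a b => ?_)
  · have := hinj _ _ _ _ (hF a) (h ▸ hF a') i hi
    simpa [σ] using hf i this
  · have := hinj _ _ _ _ (hF' b) (h ▸ hF' b') i' hi₂
    simpa [σ, hne.symm] using hf i' this
  · obtain ⟨v, v', hv, hv', h⟩ := key a.castSucc b.castSucc
    rw [hF] at hv
    rw [hF'] at hv'
    cases hv
    cases hv'
    exact h

/-! ### Subdivisions -/

namespace SimpleGraph

theorem subdivisionPath_zero {V : Type u} (H : SimpleGraph V) (s : H.edgeSet → ℕ)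
    (e : H.edgeSet) : H.subdivisionPath s e 0 = Sum.inl (Quot.out e.1).1 := by
  simp [subdivisionPath]

theorem subdivisionPath_inner {V : Type u} (H : SimpleGraph V) (s : H.edgeSet → ℕ)
    (e : H.edgeSet) {i : ℕ} (h : i < s e) :
    H.subdivisionPath s e (i + 1) = Sum.inr ⟨e, ⟨i, h⟩⟩ := by
  simp [subdivisionPath, h]

theorem subdivisionPath_last {V : Type u} (H : SimpleGraph V) (s : H.edgeSet → ℕ)
    (e : H.edgeSet) : H.subdivisionPath s e (s e + 1) = Sum.inl (Quot.out e.1).2 := by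
  simp [subdivisionPath]

theorem mk_quotOut {V : Type u} (z : Sym2 V) : s((Quot.out z).1, (Quot.out z).2) = z :=
  Quot.out_eq z

theorem subdivision_adj_subdivisionPath {V : Type u} (H : SimpleGraph V) (s : H.edgeSet → ℕ)
    (e : H.edgeSet) {i : ℕ} (h : i ≤ s e) :
    (H.subdivision s).Adj (H.subdivisionPath s e i) (H.subdivisionPath s e (i + 1)) := by
  refine (fromEdgeSet_adj _).2 ⟨⟨e, i, h, rfl⟩, ?_⟩
  rcases h.lt_or_eq with h | rfl
  · rw [subdivisionPath_inner H s e h]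
    cases i with
    | zero => simp [subdivisionPath_zero]
    | succ i => simp [subdivisionPath_inner H s e (Nat.lt_of_succ_lt h)]
  · rw [subdivisionPath_last]
    rcases hs : s e with _ | i
    · rw [subdivisionPath_zero]
      have := e.2
      rw [← mk_quotOut e.1, mem_edgeSet] at this
      simpa using this.ne
    · simp [subdivisionPath_inner H s e (i := i) (by omega)]

/-- A graph without large bicliques and with a large clique as a topological minor of bounded depth
contains a system of disjoint short paths that connect the vertices `a p` pairwise, with inner
vertices `inner p q`, and such that different paths have no edges between their inner vertices and
that no `a p` is adjacent to an inner vertex of a path that does not start or end there. -/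
theorem exists_clean_subdivision (t r : ℕ) (ι : Type) [Finite ι] :
    ∃ N : ℕ, ∀ {V : Type u} (G : SimpleGraph V),
      ¬ (completeBipartiteGraph (Fin t) (Fin t)).IsContained G →
      ∀ {W : Type u} (H : SimpleGraph W), H.IsTopologicalMinorOfDepth r G → N ≤ H.cliqueNum →
      ∃ (a : ι → V) (inner : ι → ι → Set V),
        (∀ p q, p ≠ q → ∃ (s : ℕ) (g : ℕ → V), s ≤ 2 * r ∧
          (g 0 = a p ∧ g (s + 1) = a q ∨ g 0 = a q ∧ g (s + 1) = a p) ∧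
          (∀ i ≤ s, G.Adj (g i) (g (i + 1))) ∧ ∀ i < s, g (i + 1) ∈ inner p q) ∧
        (∀ p q, ¬ G.Adj (a p) (a q)) ∧
        (∀ p q w p', w ∈ inner p q → G.Adj (a p') w → p' = p ∨ p' = q) ∧
        (∀ p q w p' q' w', w ∈ inner p q → w' ∈ inner p' q' → G.Adj w w' →
          s(p, q) = s(p', q')) := by
  obtain ⟨n, hn⟩ := exists_point_adj_imp_comparable.{u} t ι (ι ⊕ (ι × ι) × Fin (2 * r))
  refine ⟨Nat.card (ι × Fin n), fun {V} G hG {W} H ⟨s, hs, ⟨φ⟩⟩ hN => ?_⟩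
  obtain ⟨C, hC⟩ := H.exists_isNClique_cliqueNum
  have := Fintype.ofFinite ι
  obtain ⟨emb⟩ : Nonempty (ι × Fin n ↪ C) :=
    Function.Embedding.nonempty_of_card_le (by
      rw [Fintype.card_coe, hC.card_eq, ← Nat.card_eq_fintype_card]; exact hN)
  have hemb : ∀ x y, x ≠ y → H.Adj (emb x) (emb y) := fun x y h =>
    hC.isClique (emb x).2 (emb y).2 fun h' => h (emb.injective (Subtype.ext h'))
  have emb_inj : Function.Injective fun x => (emb x : W) :=
    Subtype.val_injective.comp emb.injective
  classical
  let edge (x y : ι × Fin n) (h : x ≠ y) : H.edgeSet := ⟨s((emb x : W), (emb y : W)), hemb x y h⟩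
  -- Paths may have fewer than `2 * r` inner vertices, and `p = q` gives no path when `x = y`; in
  -- both cases the object is undefined.
  let obE (x y : ι × Fin n) (k : ℕ) : Option V :=
    if h : x ≠ y then if hk : k < s (edge x y h) then some (φ (Sum.inr ⟨edge x y h, ⟨k, hk⟩⟩))
      else none else none
  have obE_eq_some : ∀ x y k v, obE x y k = some v ↔ ∃ (h : x ≠ y) (hk : k < s (edge x y h)),
      φ (Sum.inr ⟨edge x y h, ⟨k, hk⟩⟩) = v := by
    intro x y k v
    simp only [obE]
    split_ifs with h hk
    · simp [h, hk]
    · simp [h, hk]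
    · simp [h]
  have obE_inj : ∀ x y x' y' k v, obE x y k = some v → obE x' y' k = some v →
      x ≠ y ∧ s(x, y) = s(x', y') := by
    intro x y x' y' k v h h'
    obtain ⟨h₁, h₂, rfl⟩ := (obE_eq_some _ _ _ _).1 h
    obtain ⟨h₁', h₂', h₃⟩ := (obE_eq_some _ _ _ _).1 h'
    have h₄ := congrArg Sigma.fst (Sum.inr_injective (φ.injective h₃))
    have h₅ : s((emb x' : W), (emb y' : W)) = s((emb x : W), (emb y : W)) :=
      congrArg Subtype.val h₄
    exact ⟨h₁, Sym2.map.injective emb_inj h₅.symm⟩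
  let ob (τ : ι → Fin n) : ι ⊕ (ι × ι) × Fin (2 * r) → Option V :=
    Sum.elim (fun p => some (φ (Sum.inl (emb (p, τ p)))))
      fun x => obE (x.1.1, τ x.1.1) (x.1.2, τ x.1.2) x.2
  let supp : ι ⊕ (ι × ι) × Fin (2 * r) → Set ι := Sum.elim (fun p => {p}) fun x => {x.1.1, x.1.2}
  obtain ⟨τ, hτ⟩ := hn G hG supp ob (by
      rintro τ τ' (p | ⟨⟨p, q⟩, k⟩) h
      · simp [ob, h p rfl]
      · simp [ob, h p (by simp [supp]), h q (by simp [supp])]) (by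
      rintro τ τ' (p | ⟨⟨p, q⟩, k⟩) v hv hv' i hi
      · cases hi
        simp only [ob, Sum.elim_inl] at hv hv'
        have h := emb_inj (Sum.inl_injective (φ.injective (Option.some_injective _
          (hv.trans hv'.symm))))
        exact congrArg Prod.snd h
      · obtain ⟨h₁, h₂⟩ := obE_inj _ _ _ _ _ _ hv hv'
        have h₃ : τ p = τ' p ∧ τ q = τ' q := by
          simp only [Sym2.eq_iff, Prod.mk.injEq] at h₂
          grind
        rcases hi with rfl | rfl
        exacts [h₃.1, h₃.2])
  refine ⟨fun p => φ (Sum.inl (emb (p, τ p))),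
    fun p q => {v | ∃ k : Fin (2 * r), p ≠ q ∧ ob τ (.inr ((p, q), k)) = some v}, ?_, ?_, ?_, ?_⟩
  · intro p q hpq
    have hxy : (p, τ p) ≠ (q, τ q) := by simp [hpq]
    let e := edge _ _ hxy
    refine ⟨s e, fun i => φ (H.subdivisionPath s e i), hs e, ?_, fun i hi => ?_, fun i hi => ?_⟩
    · simp only [subdivisionPath_zero, subdivisionPath_last]
      have := mk_quotOut e.1
      rcases Sym2.eq_iff.1 this with ⟨h, h'⟩ | ⟨h, h'⟩ <;> simp [h, h']
    · exact φ.toHom.map_adj (subdivision_adj_subdivisionPath H s e hi)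
    · refine ⟨⟨i, hi.trans_le (hs e)⟩, hpq, (obE_eq_some _ _ _ _).2 ⟨hxy, hi, ?_⟩⟩
      simp only [subdivisionPath_inner H s e hi]
      rfl
  · intro p q h
    have := hτ (.inl p) (.inl q) _ _ rfl rfl h
    simp only [supp, Sum.elim_inl, Set.singleton_subset_iff, Set.mem_singleton_iff] at this
    rcases this with rfl | rfl <;> exact h.ne rfl
  · rintro p q w p' ⟨k, hpq, hk⟩ h
    have := hτ (.inl p') (.inr ((p, q), k)) _ _ rfl hk h
    simp only [supp, Sum.elim_inl, Sum.elim_inr, Set.singleton_subset_iff, Set.mem_insert_iff,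
      Set.mem_singleton_iff, Set.insert_subset_iff] at this
    rcases this with h | ⟨rfl, rfl⟩
    exacts [h, .inl rfl]
  · rintro p q w p' q' w' ⟨k, hpq, hk⟩ ⟨k', hpq', hk'⟩ h
    have := hτ (.inr ((p, q), k)) (.inr ((p', q'), k')) _ _ hk hk' h
    simp only [supp, Sum.elim_inr, Set.singleton_subset_iff, Set.mem_insert_iff,
      Set.mem_singleton_iff, Set.insert_subset_iff] at this
    -- Both supports have exactly two elements, so comparable means equal.
    rw [Sym2.eq_iff]
    grind

end SimpleGraph

/-- A large biclique contains the 1-subdivision of a clique on `f 1 + 1` vertices: principal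
vertices go to one side, edges to the other. -/
theorem GraphClass.IsNowhereDense.isWeaklySparse {C : GraphClass.{u}} (hC : C.IsNowhereDense) :
    C.IsWeaklySparse := by
  obtain ⟨f, hf⟩ := hC
  let K : SimpleGraph (ULift.{u} (Fin (f 1 + 1))) := ⊤
  have := Fintype.ofFinite K.edgeSet
  have h₁ := le_max_left (f 1 + 1) (Fintype.card K.edgeSet)
  have h₂ := le_max_right (f 1 + 1) (Fintype.card K.edgeSet)
  refine ⟨max (f 1 + 1) (Fintype.card K.edgeSet), fun G hG hK => ?_⟩
  have hmin : K.IsTopologicalMinorOfDepth 1 G.graph := by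
    refine ⟨fun _ => 1, by simp, SimpleGraph.IsContained.trans ⟨⟨⟨Sum.map
      (fun i => Fin.castLE h₁ i.down)
      (fun x => Fin.castLE h₂ (Fintype.equivFin _ x.1)), ?_⟩, ?_⟩⟩ hK⟩
    · intro x y hxy
      obtain ⟨⟨e, i, hi, h⟩, -⟩ := (SimpleGraph.fromEdgeSet_adj _).1 hxy
      have h₀ := K.subdivisionPath_zero (fun _ => 1) e
      have h₁ := K.subdivisionPath_inner (fun _ => 1) e (i := 0) (by simp)
      have h₂ := K.subdivisionPath_last (fun _ => 1) e
      simp only [zero_add] at h₁ h₂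
      interval_cases i
      · rw [h₀, zero_add, h₁] at h
        rcases Sym2.eq_iff.1 h with ⟨rfl, rfl⟩ | ⟨rfl, rfl⟩ <;> simp
      · rw [h₁, h₂] at h
        rcases Sym2.eq_iff.1 h with ⟨rfl, rfl⟩ | ⟨rfl, rfl⟩ <;> simp
    · refine Sum.map_injective.2
        ⟨(Fin.castLE_injective h₁).comp ULift.down_injective, fun x y h => ?_⟩
      have h := (Fintype.equivFin _).injective (Fin.castLE_injective h₂ h)
      obtain ⟨e, k⟩ := x
      obtain ⟨e', k'⟩ := y
      obtain rfl : e = e' := h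
      rw [Subsingleton.elim k k']
  have hc := hf 1 G hG ⟨_, K⟩ hmin
  have h₃ : (Finset.univ : Finset (ULift.{u} (Fin (f 1 + 1)))).card ≤ K.cliqueNum :=
    SimpleGraph.IsClique.card_le_cliqueNum (tc := fun x _ y _ h => h)
  have h₄ := h₃.trans hc
  simp at h₄

/-! ### First-order formulas in monadic lifts -/

namespace SimpleGraph

/-- `x` and `y` are joined by a walk with at most `k` inner vertices, all of them in `U`. -/
def WalkThrough {V : Type u} (G : SimpleGraph V) (U : Set V) : ℕ → V → V → Prop
  | 0 => G.Adj
  | k + 1 => fun x y => G.WalkThrough U k x y ∨ ∃ z, G.WalkThrough U k x z ∧ z ∈ U ∧ G.Adj z y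

theorem WalkThrough.mono {V : Type u} {G : SimpleGraph V} {U : Set V} {k m : ℕ} {x y : V}
    (h : G.WalkThrough U k x y) (hkm : k ≤ m) : G.WalkThrough U m x y := by
  induction hkm with
  | refl => exact h
  | step _ ih => exact .inl ih

theorem WalkThrough.of_path {V : Type u} {G : SimpleGraph V} {U : Set V} {g : ℕ → V} {s : ℕ}
    (h : ∀ i ≤ s, G.Adj (g i) (g (i + 1))) (hU : ∀ i < s, g (i + 1) ∈ U) :
    G.WalkThrough U s (g 0) (g (s + 1)) := by
  induction s with
  | zero => exact h 0 le_rfl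
  | succ s ih =>
    exact .inr ⟨g (s + 1), ih (fun i hi => h i (by omega)) (fun i hi => hU i (by omega)),
      hU s (by omega), h _ le_rfl⟩

/-- Induction along the walk: a set `S` closed under steps into `U`, also from `x`, traps every
inner vertex. -/
theorem WalkThrough.exists_adj {V : Type u} {G : SimpleGraph V} {U S : Set V} {x y : V} {k : ℕ}
    (h : G.WalkThrough U k x y) (hS : ∀ z w, z = x ∨ z ∈ S → w ∈ U → G.Adj z w → w ∈ S) :
    ∃ z, (z = x ∨ z ∈ S ∧ z ∈ U) ∧ G.Adj z y := by
  induction k generalizing y with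
  | zero => exact ⟨x, .inl rfl, h⟩
  | succ k ih =>
    rcases h with h | ⟨z, h, hz, hzy⟩
    · exact ih h
    · obtain ⟨z', hz', hadj⟩ := ih h
      exact ⟨z, .inr ⟨hS z' z (hz'.imp_right And.left) hz hadj, hz⟩, hzy⟩

end SimpleGraph

theorem exists_formula_walkThrough (k : ℕ) :
    ∃ φ : (markedGraphLanguage 1).Formula (Fin 2), ∀ {V : Type u} (G : SimpleGraph V)
      (U : Fin 1 → Set V) (v : Fin 2 → V),
      G.LiftSatisfies U φ v ↔ G.WalkThrough (U 0) k (v 0) (v 1) := by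
  induction k with
  | zero =>
    refine ⟨Language.Relations.formula₂ (Sum.inl Language.adj) (.var 0) (.var 1),
      fun G U v => ?_⟩
    let := G.monadicLift U
    exact Language.Formula.realize_rel₂
  | succ k ih =>
    obtain ⟨φ, hφ⟩ := ih
    let ψ : (markedGraphLanguage 1).Formula (Fin 2 ⊕ Unit) :=
      φ.relabel ![.inl 0, .inr ()] ⊓
        (Language.Relations.formula₁ (Sum.inr (UnaryRel.mark 0)) (.var (.inr ())) ⊓
          Language.Relations.formula₂ (Sum.inl Language.adj) (.var (.inr ())) (.var (.inl 1)))
    refine ⟨φ ⊔ Language.Formula.iExs Unit ψ, fun {V} G U v => ?_⟩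
    let := G.monadicLift U
    have h : ∀ i : Unit → V, ψ.Realize (Sum.elim v i) ↔
        G.WalkThrough (U 0) k (v 0) (i ()) ∧ i () ∈ U 0 ∧ G.Adj (i ()) (v 1) := by
      intro i
      simp only [ψ, Language.Formula.realize_inf, Language.Formula.realize_relabel]
      refine and_congr ?_ (and_congr ?_ ?_)
      · exact hφ G U _
      · exact Language.Formula.realize_rel₁
      · exact Language.Formula.realize_rel₂
    refine Language.Formula.realize_sup.trans (or_congr (hφ G U v) ?_)
    rw [Language.Formula.realize_iExs]
    simp only [h]
    exact ⟨fun ⟨i, hi⟩ => ⟨i (), hi⟩, fun ⟨z, hz⟩ => ⟨fun _ => z, hz⟩⟩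

/-- Formulas remain meaningful when more unary predicates are added. -/
theorem exists_formula_append {n : ℕ} (m : ℕ) {β : Type} (φ : (markedGraphLanguage n).Formula β) :
    ∃ ψ : (markedGraphLanguage (n + m)).Formula β, ∀ {V : Type u} (G : SimpleGraph V)
      (U : Fin n → Set V) (X : Fin m → Set V) (v : β → V),
      G.LiftSatisfies (Fin.append U X) ψ v ↔ G.LiftSatisfies U φ v := by
  let F : unaryLanguage n →ᴸ unaryLanguage (n + m) :=
    { onFunction := fun _ f => Empty.elim f
      onRelation := fun _ R => match R with
        | .mark j => .mark (Fin.castAdd m j) }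
  let F' : markedGraphLanguage n →ᴸ markedGraphLanguage (n + m) :=
    (Language.LHom.id Language.graph).sumMap F
  refine ⟨F'.onFormula φ, fun {V} G U X v => ?_⟩
  let := G.monadicLift U
  let := G.monadicLift (Fin.append U X)
  have : F'.IsExpansionOn V := by
    refine ⟨fun f x => ?_, fun R x => ?_⟩
    · rcases f with f | f <;> exact Empty.elim f
    · rcases R with R | R
      · rfl
      · rcases R with ⟨j⟩
        change (x 0 ∈ Fin.append U X (Fin.castAdd m j)) = (x 0 ∈ U j)
        rw [Fin.append_left]
  exact Language.LHom.realize_onFormula F' φ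

theorem exists_eq_var_of_markedGraphLanguage {n : ℕ} {β : Type}
    (t : (markedGraphLanguage n).Term β) : ∃ x, t = .var x := by
  cases t with
  | var x => exact ⟨x, rfl⟩
  | func f _ => rcases f with f | f <;> exact Empty.elim f

/-- Formulas can be pulled back along an interpretation, with additional unary predicates. -/
theorem GraphInterpretation.exists_pullback {n m : ℕ} (I : GraphInterpretation n) {α : Type}
    {k : ℕ} (φ : (markedGraphLanguage m).BoundedFormula α k) :
    ∃ ψ : (markedGraphLanguage (n + m)).BoundedFormula α k,
      ∀ {V W : Type u} (G : SimpleGraph V) (U : Fin n → Set V) (H : SimpleGraph W)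
        (X : Fin m → Set W) (e : H.Adj ≃r I.edge G U) (v : α → W) (xs : Fin k → W),
        @Language.BoundedFormula.Realize _ V
          (G.monadicLift (Fin.append U fun j => (fun w => (e w).1) '' X j)) _ _ ψ
            (fun a => (e (v a)).1) (fun i => (e (xs i)).1) ↔
        @Language.BoundedFormula.Realize _ W (H.monadicLift X) _ _ φ v xs := by
  have elim_eq : ∀ {V W : Type u} {k : ℕ} (f : W → V) (v : α → W) (xs : Fin k → W) (x),
      Sum.elim (fun a => f (v a)) (fun i => f (xs i)) x = f (Sum.elim v xs x) := by
    rintro V W k f v xs (x | x) <;> rfl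
  obtain ⟨ν, hν⟩ := exists_formula_append.{u} m I.ν
  obtain ⟨η, hη⟩ := exists_formula_append.{u} m I.η
  induction φ with
  | falsum => exact ⟨.falsum, fun _ _ _ _ _ _ _ => Iff.rfl⟩
  | equal t₁ t₂ =>
    obtain ⟨x, rfl⟩ := exists_eq_var_of_markedGraphLanguage t₁
    obtain ⟨y, rfl⟩ := exists_eq_var_of_markedGraphLanguage t₂
    refine ⟨.equal (.var x) (.var y), fun {V W} G U H X e v xs => ?_⟩
    have hE : Function.Injective fun w => (e w).1 := Subtype.val_injective.comp e.injective
    change Sum.elim _ _ x = Sum.elim _ _ y ↔ Sum.elim _ _ x = Sum.elim _ _ y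
    rw [elim_eq fun w => (e w).1, elim_eq fun w => (e w).1]
    exact hE.eq_iff
  | @rel k l R ts =>
    choose x hx using fun i => exists_eq_var_of_markedGraphLanguage (ts i)
    obtain rfl : ts = fun i => .var (x i) := funext hx
    rcases R with R | R
    · rcases R with ⟨⟩
      -- Adjacency becomes `η`; as all terms are variables, substitution is mere relabelling.
      let η' : (markedGraphLanguage (n + m)).BoundedFormula α (k + 0) :=
        Language.BoundedFormula.relabel x η
      refine ⟨η', fun {V W} G U H X e v xs => ?_⟩
      let := G.monadicLift (Fin.append U fun j => (fun w => (e w).1) '' X j)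
      have h := hη G U (fun j => (fun w => (e w).1) '' X j)
        ![(e (Sum.elim v xs (x 0))).1, (e (Sum.elim v xs (x 1))).1]
      refine Language.BoundedFormula.realize_relabel.trans
        (Iff.trans (iff_of_eq ?_) (h.trans (e.map_rel_iff (a := Sum.elim v xs (x 0)))))
      unfold SimpleGraph.LiftSatisfies Language.Formula.Realize
      congr 1
      · ext j
        fin_cases j <;> exact elim_eq (fun w => (e w).1) v xs _
      · exact Subsingleton.elim _ _
    · rcases R with ⟨j⟩
      refine ⟨.rel (Sum.inr (UnaryRel.mark (Fin.natAdd n j))) fun i => .var (x i),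
        fun {V W} G U H X e v xs => ?_⟩
      have hE : Function.Injective fun w => (e w).1 := Subtype.val_injective.comp e.injective
      change Sum.elim (fun a => (e (v a)).1) (fun i => (e (xs i)).1) (x 0) ∈
        Fin.append U (fun j => (fun w => (e w).1) '' X j) (Fin.natAdd n j) ↔
          Sum.elim v xs (x 0) ∈ X j
      rw [elim_eq fun w => (e w).1, Fin.append_right]
      exact hE.mem_set_image
  | imp _ _ ih₁ ih₂ =>
    obtain ⟨ψ₁, h₁⟩ := ih₁
    obtain ⟨ψ₂, h₂⟩ := ih₂
    exact ⟨ψ₁.imp ψ₂, fun G U H X e v xs =>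
      imp_congr (h₁ G U H X e v xs) (h₂ G U H X e v xs)⟩
  | @all k φ ih =>
    obtain ⟨ψ, hψ⟩ := ih
    -- Quantifiers are relativised to the domain formula.
    let ν' : (markedGraphLanguage (n + m)).BoundedFormula α (k + 1) :=
      Language.BoundedFormula.relabel (fun _ : Fin 1 => Sum.inr (Fin.last k)) ν
    refine ⟨(ν'.imp ψ).all, fun {V W} G U H X e v xs => ?_⟩
    let := G.monadicLift (Fin.append U fun j => (fun w => (e w).1) '' X j)
    have hdom : ∀ ys : Fin (k + 1) → V, ν'.Realize (fun a => (e (v a)).1) ys ↔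
        ys (Fin.last k) ∈ I.domain G U := by
      intro ys
      refine Language.BoundedFormula.realize_relabel.trans
        (Iff.trans (iff_of_eq ?_) (hν G U (fun j => (fun w => (e w).1) '' X j) ![_]))
      unfold SimpleGraph.LiftSatisfies Language.Formula.Realize
      congr 1
      · ext j
        fin_cases j
        rfl
      · exact Subsingleton.elim _ _
    have snoc_eq : ∀ w, (Fin.snoc (fun i => (e (xs i)).1) (e w).1 : Fin (k + 1) → V) =
        fun i => (e ((Fin.snoc xs w : Fin (k + 1) → W) i)).1 := by
      intro w
      ext i
      refine Fin.lastCases ?_ (fun i => ?_) i <;> simp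
    refine ⟨fun h w => ?_, fun h y hy => ?_⟩
    · refine (hψ G U H X e v _).1 ?_
      rw [← snoc_eq]
      exact h _ ((hdom _).2 (by simp))
    · have hy := (hdom _).1 hy
      rw [Fin.snoc_last] at hy
      obtain ⟨w, hw⟩ := e.surjective ⟨y, hy⟩
      obtain rfl : (e w).1 = y := congrArg Subtype.val hw
      rw [snoc_eq]
      exact (hψ G U H X e v _).2 (h w)

theorem GraphClass.IsMonadicallyNIP.of_transducesTo {C D : GraphClass.{u}}
    (hC : C.IsMonadicallyNIP) (hCD : C.TransducesTo D) : D.IsMonadicallyNIP := by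
  obtain ⟨n, I, hI⟩ := hCD
  intro m φ
  obtain ⟨ψ, hψ⟩ := I.exists_pullback φ
  obtain ⟨k, hk⟩ := hC (n + m) ψ
  refine ⟨k, fun H hH X l a b hab => ?_⟩
  obtain ⟨G, hG, U, ⟨e⟩⟩ := hI H hH
  refine hk G hG (Fin.append U fun j => (fun w => (e w).1) '' X j) l (fun i => (e (a i)).1)
    (fun J => (e (b J)).1) fun i J => ?_
  rw [← hab i J]
  have := hψ G.graph U H.graph X e ![a i, b J] Fin.elim0
  refine Iff.trans (iff_of_eq ?_) this
  unfold SimpleGraph.LiftSatisfies Language.Formula.Realize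
  congr 1
  · ext j
    fin_cases j <;> rfl
  · exact Subsingleton.elim _ _

/-! ### The main theorem -/

theorem GraphClass.IsMonadicallyNIP.isNowhereDense {C : GraphClass.{u}}
    (hC : C.IsMonadicallyNIP) (hw : C.IsWeaklySparse) : C.IsNowhereDense := by
  obtain ⟨t, ht⟩ := hw
  by_contra hnd
  obtain ⟨r, hr⟩ : ∃ r : ℕ, ∀ N : ℕ, ∃ G ∈ C, ∃ H : FinGraph.{u},
      H.graph.IsTopologicalMinorOfDepth r G.graph ∧ N < H.graph.cliqueNum := by
    by_contra! h
    choose f hf using h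
    exact hnd ⟨f, hf⟩
  obtain ⟨φ, hφ⟩ := exists_formula_walkThrough.{u} (2 * r)
  obtain ⟨l, hl⟩ := hC 1 φ
  obtain ⟨N, hN⟩ := SimpleGraph.exists_clean_subdivision.{u} t r
    (Fin (l + 1) ⊕ Set (Fin (l + 1)))
  obtain ⟨G, hG, H, hmin, hcl⟩ := hr N
  obtain ⟨a, inner, hpath, haa, hai, hii⟩ := hN G.graph (ht G hG) H.graph hmin hcl.le
  -- Only the paths coding `i ∈ I` are marked.
  let U : Set G.V := {w | ∃ i I, i ∈ I ∧ w ∈ inner (.inl i) (.inr I)}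
  have := hl G hG (fun _ => U) (l + 1) (a ∘ .inl) (a ∘ .inr) fun i I => ?_
  · omega
  refine (hφ G.graph (fun _ => U) _).trans ⟨fun h => ?_, fun h => ?_⟩
  · have hS : ∀ z w, z = a (.inl i) ∨ z ∈ {w | ∃ J, i ∈ J ∧ w ∈ inner (.inl i) (.inr J)} →
        w ∈ U → G.graph.Adj z w → w ∈ {w | ∃ J, i ∈ J ∧ w ∈ inner (.inl i) (.inr J)} := by
      rintro z w hz ⟨i', J', hJ', hw⟩ hadj
      have hi : i = i' := by
        rcases hz with rfl | ⟨J, hiJ, hz⟩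
        · rcases hai _ _ _ _ hw hadj with h | h <;> cases h
          rfl
        · have := hii _ _ _ _ _ _ hz hw hadj
          simp only [Sym2.eq_iff, Sum.inl.injEq, reduceCtorEq, and_false, or_false] at this
          exact this.1
      subst hi
      exact ⟨J', hJ', hw⟩
    obtain ⟨z, rfl | ⟨⟨J, hiJ, hz⟩, -⟩, hadj⟩ := SimpleGraph.WalkThrough.exists_adj h hS
    · exact (haa _ _ hadj).elim
    · rcases hai _ _ _ _ hz hadj.symm with h | h
      · cases h
      · cases h
        exact hiJ
  · obtain ⟨s, g, hs, hg, hadj, hin⟩ := hpath (.inl i) (.inr I) (by simp)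
    have hin' : ∀ j < s, g (j + 1) ∈ U := fun j hj => ⟨i, I, h, hin j hj⟩
    refine SimpleGraph.WalkThrough.mono ?_ hs
    rcases hg with ⟨h₀, h₁⟩ | ⟨h₀, h₁⟩
    · have := SimpleGraph.WalkThrough.of_path hadj hin'
      rwa [h₀, h₁] at this
    · have := SimpleGraph.WalkThrough.of_path (G := G.graph) (U := U) (s := s)
        (g := fun j => g (s + 1 - j)) (fun j hj => ?_) (fun j hj => ?_)
      · simpa [h₀, h₁] using this
      · have := (hadj (s - j) (by omega)).symm
        rwa [show s - j + 1 = s + 1 - j by omega,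
          show s - j = s + 1 - (j + 1) by omega] at this
      · have := hin' (s - j - 1) (by omega)
        rwa [show s - j - 1 + 1 = s + 1 - (j + 1) by omega] at this

theorem mainTheorem12 (C : GraphClass.{u}) (hC : C.IsMonadicallyNIP) :
    (C.IsNowhereDense ↔ C.IsWeaklySparse) ∧
      (C.IsSparsifiable → C.IsStructurallyNowhereDense) := by
  refine ⟨⟨fun h => h.isWeaklySparse, fun h => hC.isNowhereDense h⟩, ?_⟩
  rintro ⟨D, hD, hCD, hDC⟩
  exact ⟨D, (hC.of_transducesTo hCD).isNowhereDense hD, hDC⟩
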